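/- For integers $i,j\ge 0$ let $$B_{i,j}=\sum_{k=j-i}^{i}\binom{i}{k}\,i^{\,i-k}\left\{{k\atop j-i}\right\}\quad (j\ge i),\qquad B_{i,j}=0\quad (j<i),$$ where $\left\{{k\atop l}\right\}$ denotes the Stirling numbers of the second kind and $0^0=1$. Let $\mathrm W(z)\in\mathbb Q[[z]]$ be the Lambert $W$ function, that is, the compositional inverse of the power series $z e^{z}$. Then, in the ring $\mathbb Q[[x,y]]$ of formal power series in two variables, $$\sum_{i,j\ge 0}B_{i,j}\,x^{j}\,\frac{y^{i}}{i!}=\frac{e^{-\left(\frac{\mathrm W(-xy)}{y}+x\right)}}{1+\mathrm W(-xy)},$$ where $\mathrm W(-xy)$ is divisible by $y$, the exponent has zero constant term, and $1+\mathrm W(-xy)$ is invertible. -/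

import Mathlib

noncomputable section

namespace LambertGF

/-- The entry `B i j = ∑_{k = j - i}^{i} binom(i, k) i^(i - k) {k, j - i}` of the infinite matrix `B`
(with `{k, l}` the Stirling numbers of the second kind, which vanish for `l < 0`, so that
`B i j = 0` for `j < i`; and with `0 ^ 0 = 1`). -/
def B (i j : ℕ) : ℕ :=
  if i ≤ j then
    ∑ k ∈ Finset.Icc (j - i) i, i.choose k * i ^ (i - k) * Nat.stirlingSecond k (j - i)
  else 0

/-- The ring `ℚ⟦x, y⟧` of formal power series in two commuting variables. -/
abbrev Ser : Type := MvPowerSeries (Fin 2) ℚ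

/-- The variable `x`. -/
abbrev x : Ser := MvPowerSeries.X 0

/-- The variable `y`. -/
abbrev y : Ser := MvPowerSeries.X 1

/-- The double generating series `∑_{i, j} B i j * x ^ j * y ^ i / i!`: the exponent of `x` in the
monomial indexed by `d` is `d 0`, and that of `y` is `d 1`. -/
def genB : Ser := fun d => (B (d 1) (d 0) : ℚ) / (Nat.factorial (d 1) : ℚ)

lemma coeff_genB (i j : ℕ) :
    MvPowerSeries.coeff (Finsupp.single 0 j + Finsupp.single 1 i) genB =
      (B i j : ℚ) / (Nat.factorial i : ℚ) := by
  change (B _ _ : ℚ) / (Nat.factorial _ : ℚ) = _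
  simp

/-- The series `z * e ^ z`. -/
def zExp : PowerSeries ℚ := PowerSeries.X * PowerSeries.exp ℚ

lemma constantCoeff_zExp : zExp.constantCoeff = 0 := by
  simp [zExp]

lemma isUnit_coeff_one_zExp : IsUnit (zExp.coeff 1) := by
  have h : zExp.coeff 1 = 1 := by
    rw [zExp, show (1 : ℕ) = 0 + 1 from rfl, PowerSeries.coeff_succ_X_mul]
    simp
  rw [h]
  exact isUnit_one

/-- The Lambert `W` function as a power series: the compositional inverse of `z * e ^ z`. -/
def lambertW : PowerSeries ℚ := zExp.substInvOfIsUnit isUnit_coeff_one_zExp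

lemma constantCoeff_lambertW : lambertW.constantCoeff = 0 :=
  PowerSeries.constantCoeff_substInvOfIsUnit _ _

lemma zExp_subst_lambertW : zExp.subst lambertW = PowerSeries.X :=
  PowerSeries.subst_substInvOfIsUnit_right _ constantCoeff_zExp _

lemma lambertW_subst_zExp : lambertW.subst zExp = PowerSeries.X :=
  PowerSeries.subst_substInvOfIsUnit_left _ constantCoeff_zExp _

/-- The functional equation `W e ^ W = z`. -/
lemma lambertW_mul_exp : lambertW * (PowerSeries.exp ℚ).subst lambertW = PowerSeries.X := by
  have h : PowerSeries.HasSubst lambertW :=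
    PowerSeries.HasSubst.of_constantCoeff_zero' constantCoeff_lambertW
  rw [← zExp_subst_lambertW, zExp, PowerSeries.subst_mul h, PowerSeries.subst_X h]

/-- The two-variable series `W(-xy)`. -/
def Wxy : Ser := lambertW.subst (-(x * y))

/-- The quotient by `y` of a series all of whose monomials are divisible by `y`. -/
def divY (f : Ser) : Ser := fun d => MvPowerSeries.coeff (d + Finsupp.single 1 1) f

/-- The exponential `e ^ f` of a series `f` without constant term. -/
def expS (f : Ser) : Ser := (PowerSeries.exp ℚ).subst f

lemma hasSubst_neg_xy : PowerSeries.HasSubst (-(x * y) : Ser) :=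
  PowerSeries.HasSubst.of_constantCoeff_zero (by simp)

lemma exists_Wxy_eq : ∃ h : Ser, Wxy = y * (x * h) := by
  have h : lambertW.constantCoeff = 0 := constantCoeff_lambertW
  obtain ⟨g, hg⟩ := PowerSeries.X_dvd_iff.mpr h
  refine ⟨-g.subst (-(x * y)), ?_⟩
  rw [Wxy, hg, PowerSeries.subst_mul hasSubst_neg_xy, PowerSeries.subst_X hasSubst_neg_xy]
  ring

lemma y_dvd_Wxy : y ∣ Wxy := by
  obtain ⟨h, hh⟩ := exists_Wxy_eq
  exact ⟨_, hh⟩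

lemma divY_y_mul (g : Ser) : divY (y * g) = g := by
  ext d
  change MvPowerSeries.coeff (d + Finsupp.single 1 1) (y * g) = _
  rw [add_comm d, y, MvPowerSeries.X, MvPowerSeries.coeff_add_monomial_mul, one_mul]

lemma y_mul_divY {f : Ser} (hf : y ∣ f) : y * divY f = f := by
  obtain ⟨g, rfl⟩ := hf
  rw [divY_y_mul]

/-- `divY Wxy` is the quotient `W(-xy) / y`. -/
lemma y_mul_divY_Wxy : y * divY Wxy = Wxy := y_mul_divY y_dvd_Wxy

lemma constantCoeff_Wxy : MvPowerSeries.constantCoeff Wxy = 0 := by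
  rw [← y_mul_divY_Wxy]
  simp

/-- The exponent `-(W(-xy)/y + x)` has no constant term, so its exponential makes sense. -/
lemma hasSubst_exponent : PowerSeries.HasSubst (-(divY Wxy + x) : Ser) := by
  obtain ⟨h, hh⟩ := exists_Wxy_eq
  rw [hh, divY_y_mul]
  apply PowerSeries.HasSubst.of_constantCoeff_zero
  simp

/-- The denominator `1 + W(-xy)` is invertible. -/
lemma one_add_Wxy_mul_inv : (1 + Wxy) * (1 + Wxy)⁻¹ = 1 :=
  MvPowerSeries.mul_inv_cancel _ (by simp [constantCoeff_Wxy])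

end LambertGF

end

namespace LambertGF

open PowerSeries

/-! With `m = j - i`, the exponential series of the Stirling numbers gives `B i j / i! = [t^i] (e^t
- 1)^m e^(i t) / m!`. Lagrange inversion for the tree function `T = z e^T`, `T(z) = -W(-z)`, says `∑
i, ([t^i] H(t) e^(i t)) z^i = H(T) / (1 - T)` (`diagExp_eq`, `one_sub_treeT_mul_diagExp_one`).
Taking `H = (e^t - 1)^m` and `z = x y`, then summing against `x^m / m!`, yields `exp(x (e^T - 1)) /
(1 - T)`. Since `x e^T = T / y = -W(-xy) / y`, this is the right-hand side. -/

/-- The coefficients of `(e ^ t - 1) ^ m` are given by the Stirling numbers of the second kind. -/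
lemma coeff_exp_sub_one_pow (k m : ℕ) :
    coeff k ((exp ℚ - 1) ^ m) = (m.factorial * Nat.stirlingSecond k m : ℚ) / k.factorial := by
  induction k generalizing m with
  | zero =>
    cases m with
    | zero => simp
    | succ m => simp
  | succ k ih =>
    cases m with
    | zero => simp [coeff_one]
    | succ m =>
      -- Comparing coefficients in this differential equation gives the recurrence `S(k+1, m+1) =
      -- (m+1) S(k, m+1) + S(k, m)`.
      have hd : d⁄dX ℚ ((exp ℚ - 1) ^ (m + 1)) =
          (m + 1 : ℕ) • ((exp ℚ - 1) ^ (m + 1) + (exp ℚ - 1) ^ m) := by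
        rw [derivative_pow, map_sub, derivative_exp, derivative_one, nsmul_eq_mul]
        simp only [Nat.add_sub_cancel]
        ring
      have hc := coeff_derivative ((exp ℚ - 1) ^ (m + 1)) k
      rw [hd, map_nsmul, map_add, ih, ih] at hc
      have hk : (k + 1 : ℚ) ≠ 0 := by positivity
      have hkf : (k.factorial : ℚ) ≠ 0 := by positivity
      rw [← mul_right_cancel_iff_of_pos (show (0 : ℚ) < k + 1 by positivity), ← hc,
        Nat.stirlingSecond_succ_succ, Nat.factorial_succ, Nat.factorial_succ, nsmul_eq_mul]
      push_cast
      field_simp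

lemma coeff_exp_pow (n i : ℕ) : coeff i (exp ℚ ^ n) = (n : ℚ) ^ i / i.factorial := by
  rw [exp_pow_eq_rescale_exp, coeff_rescale, coeff_exp]
  simp [div_eq_mul_inv]

/-! ### Lagrange inversion: the diagonal operator -/

/-- The operator sending `H` to the series `∑ i, ([t ^ i] (H(t) e ^ (i t))) z ^ i`. -/
noncomputable def diagExp (H : PowerSeries ℚ) : PowerSeries ℚ := PowerSeries.mk fun i => coeff i (H * exp ℚ ^ i)

lemma coeff_diagExp (H : PowerSeries ℚ) (i : ℕ) :
    coeff i (diagExp H) = coeff i (H * exp ℚ ^ i) := coeff_mk _ _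

lemma diagExp_add (G H : PowerSeries ℚ) : diagExp (G + H) = diagExp G + diagExp H := by
  ext i
  simp [coeff_diagExp, add_mul]

lemma diagExp_C_mul (a : ℚ) (H : PowerSeries ℚ) : diagExp (C a * H) = C a * diagExp H := by
  ext i
  simp [coeff_diagExp, mul_assoc]

/-- The series `z * e ^ (-z)`. -/
noncomputable def zExpNeg : PowerSeries ℚ := X * evalNegHom (exp ℚ)

lemma hasSubst_zExpNeg : HasSubst zExpNeg :=
  HasSubst.of_constantCoeff_zero' (by simp [zExpNeg])

/-- The factor `e^(-t)` turns `e^((i+1)t)` into `e^(it)`, and the factor `t` lowers the coefficient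
index to match. -/
lemma diagExp_zExpNeg_mul (H : PowerSeries ℚ) : diagExp (zExpNeg * H) = X * diagExp H := by
  ext i
  cases i with
  | zero => simp [coeff_diagExp, zExpNeg]
  | succ i =>
    have h : zExpNeg * H * exp ℚ ^ (i + 1) = X * (H * exp ℚ ^ i) := by
      rw [zExpNeg]
      linear_combination X * (H * exp ℚ ^ i) * exp_mul_exp_neg_eq_one (A := ℚ)
    rw [coeff_succ_X_mul, coeff_diagExp, coeff_diagExp, h, coeff_succ_X_mul]

/-- Iterates the shift rule: writing `A = X * G + a`, the coefficient of index `i + 1` for `A`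
reduces to that of index `i` for `G`, which is why the induction generalizes `A`. -/
lemma diagExp_subst_mul (A H : PowerSeries ℚ) :
    diagExp (A.subst zExpNeg * H) = A * diagExp H := by
  ext i
  induction i generalizing A with
  | zero =>
    have hA : constantCoeff (A.subst zExpNeg) = constantCoeff A := by
      obtain ⟨G, hG⟩ : ∃ G, A = X * G + C (constantCoeff A) := ⟨_, A.eq_X_mul_shift_add_const⟩
      rw [hG, subst_add hasSubst_zExpNeg, subst_mul hasSubst_zExpNeg, subst_X hasSubst_zExpNeg,
        subst_C]
      have : (MvPowerSeries.C (constantCoeff A) : MvPowerSeries Unit ℚ) = C (constantCoeff A) := rfl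
      rw [this]
      simp [zExpNeg]
    have hH : constantCoeff (diagExp H) = constantCoeff H := by
      simpa using coeff_diagExp H 0
    rw [coeff_diagExp, pow_zero, mul_one, coeff_zero_eq_constantCoeff, map_mul, map_mul, hA, hH]
  | succ i ih =>
    obtain ⟨G, hG⟩ : ∃ G, A = X * G + C (constantCoeff A) := ⟨_, A.eq_X_mul_shift_add_const⟩
    generalize constantCoeff A = a at hG
    have hs : A.subst zExpNeg = zExpNeg * G.subst zExpNeg + C a := by
      rw [hG, subst_add hasSubst_zExpNeg, subst_mul hasSubst_zExpNeg, subst_X hasSubst_zExpNeg,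
        subst_C]
      rfl
    rw [hs, add_mul, diagExp_add, mul_assoc, diagExp_zExpNeg_mul, diagExp_C_mul, map_add,
      coeff_succ_X_mul, ih, hG, add_mul, map_add, mul_assoc, coeff_succ_X_mul]

/-- For `n ≥ 1` the two contributions `n^n / n!` and `n^(n-1) / (n-1)!` are equal. This
normalization is what determines `diagExp 1` as `1 / (1 - T)`. -/
lemma diagExp_one_sub_X : diagExp (1 - X) = 1 := by
  ext i
  cases i with
  | zero => simp [coeff_diagExp]
  | succ i =>
    rw [coeff_diagExp, sub_mul, one_mul, map_sub, coeff_succ_X_mul, coeff_exp_pow, coeff_exp_pow,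
      coeff_one, if_neg (Nat.succ_ne_zero i), Nat.factorial_succ]
    push_cast
    field_simp
    ring

/-! ### The tree function -/

lemma hasSubst_neg_X : HasSubst (-X : PowerSeries ℚ) :=
  HasSubst.of_constantCoeff_zero' (by simp)

/-- The tree function `T(z) = -W(-z)`. -/
noncomputable def treeT : PowerSeries ℚ := -lambertW.subst (-X : PowerSeries ℚ)

lemma hasSubst_lambertW : HasSubst lambertW :=
  HasSubst.of_constantCoeff_zero' constantCoeff_lambertW

lemma evalNegHom_eq_subst (f : PowerSeries ℚ) : evalNegHom f = f.subst (-X : PowerSeries ℚ) := by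
  rw [evalNegHom, rescale_eq_subst]
  simp

lemma subst_neg {τ : Type*} {a : MvPowerSeries τ ℚ} (ha : HasSubst a) (f : PowerSeries ℚ) :
    (-f).subst a = -f.subst a := by
  rw [← coe_substAlgHom ha, map_neg]

lemma subst_one {τ : Type*} {a : MvPowerSeries τ ℚ} (ha : HasSubst a) :
    (1 : PowerSeries ℚ).subst a = 1 := by
  rw [← coe_substAlgHom ha, map_one]

lemma constantCoeff_treeT : constantCoeff treeT = 0 := by
  rw [treeT, map_neg, neg_eq_zero]
  exact constantCoeff_subst_eq_zero (by simp [← PowerSeries.constantCoeff.eq_def]) _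
    constantCoeff_lambertW

lemma hasSubst_treeT : HasSubst treeT :=
  HasSubst.of_constantCoeff_zero' constantCoeff_treeT

/-- The functional equation `T = z e ^ T`. -/
lemma treeT_eq : treeT = X * (exp ℚ).subst treeT := by
  have h := congrArg (subst (-X : PowerSeries ℚ)) lambertW_mul_exp
  rw [subst_mul hasSubst_neg_X, subst_X hasSubst_neg_X,
    subst_comp_subst_apply hasSubst_lambertW hasSubst_neg_X] at h
  have hT : lambertW.subst (-X : PowerSeries ℚ) = -treeT := by rw [treeT, neg_neg]
  have hn : (exp ℚ).subst (-treeT) = (evalNegHom (exp ℚ)).subst treeT := by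
    rw [evalNegHom_eq_subst, subst_comp_subst_apply hasSubst_neg_X hasSubst_treeT,
      subst_neg hasSubst_treeT, subst_X hasSubst_treeT]
  have hu : (exp ℚ).subst treeT * (evalNegHom (exp ℚ)).subst treeT = 1 := by
    rw [← subst_mul hasSubst_treeT, exp_mul_exp_neg_eq_one, subst_one hasSubst_treeT]
  rw [hT, hn] at h
  linear_combination (-(exp ℚ).subst treeT) * h - treeT * hu

/-- Lets any `H` be written as `H(T)` evaluated at `z e^(-z)`, the form that `diagExp_subst_mul`
needs. -/
lemma treeT_subst_zExpNeg : treeT.subst zExpNeg = X := by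
  have h : (-X : PowerSeries ℚ).subst zExpNeg = zExp.subst (-X : PowerSeries ℚ) := by
    rw [subst_neg hasSubst_zExpNeg, subst_X hasSubst_zExpNeg, zExp, subst_mul hasSubst_neg_X,
      subst_X hasSubst_neg_X, zExpNeg, evalNegHom_eq_subst, neg_mul]
  rw [treeT, subst_neg hasSubst_zExpNeg, subst_comp_subst_apply hasSubst_neg_X hasSubst_zExpNeg, h,
    ← subst_comp_subst_apply (HasSubst.of_constantCoeff_zero' constantCoeff_zExp) hasSubst_neg_X,
    lambertW_subst_zExp, subst_X hasSubst_neg_X, neg_neg]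

/-- Lagrange inversion for `T = z e ^ T`. -/
lemma diagExp_eq (H : PowerSeries ℚ) : diagExp H = H.subst treeT * diagExp 1 := by
  rw [← diagExp_subst_mul, mul_one, subst_comp_subst_apply hasSubst_treeT hasSubst_zExpNeg,
    treeT_subst_zExpNeg, X_subst]

lemma one_sub_treeT_mul_diagExp_one : (1 - treeT) * diagExp 1 = 1 := by
  have h := diagExp_eq (1 - X)
  rwa [diagExp_one_sub_X, subst_sub hasSubst_treeT, subst_one hasSubst_treeT,
    subst_X hasSubst_treeT, eq_comm] at h

/-! ### Passage to two variables and comparison of coefficients -/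

lemma hasSubst_xy : HasSubst (x * y : Ser) :=
  HasSubst.of_constantCoeff_zero (by simp)

lemma Wxy_eq : Wxy = -treeT.subst (x * y : Ser) := by
  rw [treeT, subst_neg hasSubst_xy, neg_neg, subst_comp_subst_apply hasSubst_neg_X hasSubst_xy,
    subst_neg hasSubst_xy, subst_X hasSubst_xy, Wxy]

/-- The exponent equals `x * (e ^ T - 1)`, evaluated at `z = x * y`. -/
lemma exponent_eq :
    -(divY Wxy + x) = x * PowerSeries.subst (x * y : Ser) ((exp ℚ - 1).subst treeT : PowerSeries ℚ) := by
  have h : Wxy = y * (-(x * PowerSeries.subst (x * y : Ser) ((exp ℚ).subst treeT : PowerSeries ℚ))) := by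
    rw [Wxy_eq]
    conv_lhs => rw [treeT_eq]
    rw [subst_mul hasSubst_xy, subst_X hasSubst_xy]
    ring
  rw [h, divY_y_mul, subst_sub hasSubst_treeT, subst_one hasSubst_treeT, subst_sub hasSubst_xy,
    subst_one hasSubst_xy]
  ring

lemma inv_one_add_Wxy : (1 + Wxy)⁻¹ = (diagExp 1).subst (x * y : Ser) := by
  have h : (1 + Wxy) * (diagExp 1).subst (x * y : Ser) = 1 := by
    rw [Wxy_eq, ← sub_eq_add_neg, ← subst_one hasSubst_xy, ← subst_sub hasSubst_xy,
      ← subst_mul hasSubst_xy, one_sub_treeT_mul_diagExp_one]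
  calc (1 + Wxy)⁻¹ = (1 + Wxy)⁻¹ * ((1 + Wxy) * (diagExp 1).subst (x * y : Ser)) := by
        rw [h, mul_one]
    _ = (1 + Wxy) * (1 + Wxy)⁻¹ * (diagExp 1).subst (x * y : Ser) := by ring
    _ = _ := by rw [one_add_Wxy_mul_inv, one_mul]

lemma coeff_x_pow_mul_subst_xy (n i j : ℕ) (G : PowerSeries ℚ) :
    MvPowerSeries.coeff (Finsupp.single 0 j + Finsupp.single 1 i)
      (x ^ n * G.subst (x * y : Ser)) = if j = i + n then coeff i G else 0 := by
  have hmon (d : ℕ) : x ^ n * (x * y) ^ d =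
      (MvPowerSeries.monomial (Finsupp.single 0 (d + n) + Finsupp.single 1 d) (1 : ℚ) : Ser) := by
    rw [mul_pow, ← mul_assoc, ← pow_add, x, y, MvPowerSeries.X_pow_eq, MvPowerSeries.X_pow_eq,
      MvPowerSeries.monomial_mul_monomial, one_mul, add_comm n d]
  have hiff (d : ℕ) : (Finsupp.single 0 j + Finsupp.single 1 i : Fin 2 →₀ ℕ) =
      Finsupp.single 0 (d + n) + Finsupp.single 1 d ↔ i = d ∧ j = d + n := by
    constructor
    · intro h
      have h0 := DFunLike.congr_fun h 0
      have h1 := DFunLike.congr_fun h 1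
      simp at h0 h1
      exact ⟨h1, h0⟩
    · rintro ⟨rfl, rfl⟩
      rfl
  -- Truncation makes the substitution a finite sum; the remainder is divisible by `y^(i+1)` and
  -- cannot reach `y^i`.
  obtain ⟨G', hG'⟩ : ∃ G', G = X ^ (i + 1) * G' + (trunc (i + 1) G : PowerSeries ℚ) :=
    ⟨_, G.eq_X_pow_mul_shift_add_trunc (i + 1)⟩
  have hy : MvPowerSeries.coeff (Finsupp.single 0 j + Finsupp.single 1 i)
      (x ^ n * (X ^ (i + 1) * G').subst (x * y : Ser)) = 0 := by
    refine MvPowerSeries.X_pow_dvd_iff (s := (1 : Fin 2)) (n := i + 1) |>.mp ?_ _ (by simp)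
    rw [subst_mul hasSubst_xy, subst_pow hasSubst_xy, subst_X hasSubst_xy, mul_pow]
    exact Dvd.intro (x ^ n * x ^ (i + 1) * G'.subst (x * y : Ser)) (by ring)
  conv_lhs => rw [hG']
  rw [subst_add hasSubst_xy, mul_add, map_add, hy, zero_add, subst_coe hasSubst_xy,
    trunc_apply, map_sum, Finset.mul_sum, map_sum]
  have hsum (d : ℕ) : MvPowerSeries.coeff (Finsupp.single 0 j + Finsupp.single 1 i)
      (x ^ n * Polynomial.aeval (x * y : Ser) (Polynomial.monomial d (coeff d G))) =
      if i = d ∧ j = d + n then coeff d G else 0 := by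
    rw [Polynomial.aeval_monomial, ← mul_assoc, mul_comm (x ^ n), mul_assoc, hmon,
      ← Algebra.smul_def, map_smul, MvPowerSeries.coeff_monomial]
    simp only [hiff]
    split_ifs <;> simp
  simp only [hsum]
  rw [Finset.sum_eq_single i]
  · simp
  · intro d _ hd
    rw [if_neg fun h => hd h.1.symm]
  · simp

lemma coeff_expS_mul_inv (i j : ℕ) :
    MvPowerSeries.coeff (Finsupp.single 0 j + Finsupp.single 1 i)
      (expS (-(divY Wxy + x)) * (1 + Wxy)⁻¹) =
      if i ≤ j then coeff i (diagExp ((exp ℚ - 1) ^ (j - i))) / (j - i).factorial else 0 := by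
  have hf := hasSubst_exponent
  -- The exponent is divisible by `x`, so the terms of the exponential of degree above `j` do not
  -- reach `x^j`. Among the others only `n = j - i` contributes.
  obtain ⟨R, hR⟩ : ∃ R, exp ℚ = X ^ (j + 1) * R + (trunc (j + 1) (exp ℚ) : PowerSeries ℚ) :=
    ⟨_, (exp ℚ).eq_X_pow_mul_shift_add_trunc (j + 1)⟩
  have hx : MvPowerSeries.coeff (Finsupp.single 0 j + Finsupp.single 1 i)
      ((X ^ (j + 1) * R).subst (-(divY Wxy + x)) * (1 + Wxy)⁻¹) = 0 := by
    refine MvPowerSeries.X_pow_dvd_iff (s := (0 : Fin 2)) (n := j + 1) |>.mp ?_ _ (by simp)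
    rw [subst_mul hf, subst_pow hf, subst_X hf, exponent_eq, mul_pow, mul_assoc, mul_assoc]
    exact dvd_mul_right _ _
  have hterm (n : ℕ) : (-(divY Wxy + x)) ^ n * (1 + Wxy)⁻¹ =
      x ^ n * (diagExp ((exp ℚ - 1) ^ n)).subst (x * y : Ser) := by
    rw [exponent_eq, inv_one_add_Wxy, diagExp_eq (_ ^ n), subst_pow hasSubst_treeT, subst_mul hasSubst_xy,
      subst_pow hasSubst_xy, mul_pow, mul_assoc]
  rw [expS]
  conv_lhs => rw [hR]
  rw [subst_add hf, add_mul, map_add, hx, zero_add, subst_coe hf, trunc_apply, map_sum, Finset.sum_mul,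
    map_sum]
  have hsum (n : ℕ) : MvPowerSeries.coeff (Finsupp.single 0 j + Finsupp.single 1 i)
      (Polynomial.aeval (-(divY Wxy + x)) (Polynomial.monomial n (coeff n (exp ℚ))) *
        (1 + Wxy)⁻¹) =
      if j = i + n then coeff i (diagExp ((exp ℚ - 1) ^ n)) / n.factorial else 0 := by
    rw [Polynomial.aeval_monomial, mul_assoc, hterm, ← Algebra.smul_def, map_smul,
      coeff_x_pow_mul_subst_xy, coeff_exp]
    split_ifs <;> simp [div_eq_inv_mul]
  simp only [hsum]
  split_ifs with h
  · rw [Finset.sum_eq_single (j - i)]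
    · rw [if_pos (by omega)]
    · intro n _ hn
      rw [if_neg (by omega)]
    · intro hn
      simp at hn
  · exact Finset.sum_eq_zero fun n _ => if_neg (by omega)

lemma coeff_diagExp_exp_sub_one_pow (i m : ℕ) :
    coeff i (diagExp ((exp ℚ - 1) ^ m)) / m.factorial =
      ((∑ k ∈ Finset.Icc m i, i.choose k * i ^ (i - k) * Nat.stirlingSecond k m : ℕ) : ℚ) /
        i.factorial := by
  have hm : (m.factorial : ℚ) ≠ 0 := by positivity
  have hi : (i.factorial : ℚ) ≠ 0 := by positivity
  rw [coeff_diagExp, coeff_mul, Finset.Nat.sum_antidiagonal_eq_sum_range_succ_mk, Finset.sum_div,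
    Nat.cast_sum, Finset.sum_div]
  symm
  -- The Cauchy product runs from `k = 0`; its terms with `k < m` vanish with the Stirling number.
  apply Finset.sum_subset_zero_on_sdiff
  · intro k hk
    simp at hk ⊢
    omega
  · intro k hk
    simp at hk
    rw [coeff_exp_sub_one_pow, Nat.stirlingSecond_eq_zero_of_lt (by omega)]
    simp
  · intro k hk
    simp at hk
    have hk' : (k.factorial : ℚ) ≠ 0 := by positivity
    have hik : ((i - k).factorial : ℚ) ≠ 0 := by positivity
    rw [coeff_exp_sub_one_pow, coeff_exp_pow]
    push_cast
    rw [Nat.cast_choose ℚ hk.2]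
    field_simp

end LambertGF

theorem mainTheorem5 :
    LambertGF.genB =
      LambertGF.expS (-(LambertGF.divY LambertGF.Wxy + LambertGF.x)) *
        (1 + LambertGF.Wxy)⁻¹ := by
  ext d
  obtain ⟨i, j, rfl⟩ : ∃ i j, d = Finsupp.single 0 j + Finsupp.single 1 i := by
    refine ⟨d 1, d 0, ?_⟩
    ext s
    fin_cases s <;> simp
  rw [LambertGF.coeff_genB, LambertGF.coeff_expS_mul_inv, LambertGF.B]
  split_ifs
  · rw [LambertGF.coeff_diagExp_exp_sub_one_pow]
  · simp
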